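/- Let $m \ge 2$ and $n = 2m$, and let $\mathcal{S}_{n} \subset \mathbb{R}^3$ be the regular even polygon state space, i.e. the convex hull of the points $$s_k = \left( \sec\!\left(\tfrac{\pi}{n}\right)\cos\!\left(\tfrac{2k\pi}{n}\right),\ \sec\!\left(\tfrac{\pi}{n}\right)\sin\!\left(\tfrac{2k\pi}{n}\right),\ 1 \right), \qquad k = 1, \dots, n.$$ An effect on $\mathcal{S}_{n}$ is an affine function $\mathcal{S}_{n} \to [0,1]$, and an observable is a map $x \mapsto \mathsf{A}_x$ from a finite outcome set to the effects with $\sum_x \mathsf{A}_x(s) = 1$ for all $s \in \mathcal{S}_{n}$. An observable $\mathsf{A}$ with outcome set $Y$ can be simulated by a set $\mathcal{B}$ of observables if there are finitely many $\mathsf{B}^{(1)}, \dots, \mathsf{B}^{(r)} \in \mathcal{B}$, with outcome sets $X_1, \dots, X_r$, a probability distribution $(p_i)_{i=1}^r$ and a stochastic matrix $\nu$ (that is, $\nu_{(i,x)y} \ge 0$ and $\sum_{y \in Y} \nu_{(i,x)y} = 1$ for all $i$ and all $x \in X_i$) such that $$\mathsf{A}_y = \sum_{i=1}^r \sum_{x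 \in X_i} \nu_{(i,x)y}\, p_i\, \mathsf{B}^{(i)}_x \qquad \text{for all } y \in Y.$$ The minimal simulation number of a set $\mathcal{A}$ of observables is the least number of observables that suffice to simulate every element of $\mathcal{A}$ (and $\infty$ if no finite number suffices). Then the minimal simulation number of the set $\mathcal{O}$ of all observables on $\mathcal{S}_{2m}$ is finite and equals $$m + \frac{1}{3}\, m(m-1)(m-2).$$ -/

import Mathlib

namespace GPT

/-- An effect on a state space `S` (a subset of a real vector space): a function `S → [0, 1]`
which is affine, that is, respects every convex combination of two states lying in `S`. -/
structure Effect {V : Type*} [AddCommGroup V] [Module ℝ V] (S : Set V) where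
  toFun : S → ℝ
  affine' : ∀ (s t r : S) (p : ℝ), 0 ≤ p → p ≤ 1 → (r : V) = p • (s : V) + (1 - p) • (t : V) →
    toFun r = p * toFun s + (1 - p) * toFun t
  nonneg' : ∀ s, 0 ≤ toFun s
  le_one' : ∀ s, toFun s ≤ 1

instance {V : Type*} [AddCommGroup V] [Module ℝ V] (S : Set V) :
    CoeFun (Effect S) (fun _ => S → ℝ) := ⟨Effect.toFun⟩

/-- An observable on `S` with a finite set of outcomes: a map from the outcome set to the effects
on `S` whose effects sum up to the unit effect. -/
structure Observable {V : Type*} [AddCommGroup V] [Module ℝ V] (S : Set V) where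
  Outcome : Type
  [fintypeOutcome : Fintype Outcome]
  effect : Outcome → Effect S
  sum_effect : ∀ s, ∑ x, effect x s = 1

attribute [instance] Observable.fintypeOutcome

/-- A classical channel from `X` to `Y`: a right stochastic matrix, `ν x y` being the probability
that the outcome `x` is mapped to the outcome `y`. -/
def IsChannel {X Y : Type*} [Fintype Y] (ν : X → Y → ℝ) : Prop :=
  ∀ x, ν x ∈ stdSimplex ℝ Y

/-- The set of `𝓑`-simulable observables: choose finitely many observables `B i ∈ 𝓑`, measure
`B i` with probability `p i`, and apply a classical channel `ν` to the pair `(i, x)` that consists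
of the label of the measured observable and of the obtained outcome. -/
def simulable {V : Type*} [AddCommGroup V] [Module ℝ V] {S : Set V}
    (𝓑 : Set (Observable S)) : Set (Observable S) :=
  {A | ∃ (n : ℕ) (B : Fin n → Observable S) (p : Fin n → ℝ)
      (ν : (Σ i, (B i).Outcome) → A.Outcome → ℝ),
      (∀ i, B i ∈ 𝓑) ∧ p ∈ stdSimplex ℝ (Fin n) ∧ IsChannel ν ∧
      ∀ y s, A.effect y s = ∑ ix, ν ix y * (p ix.1 * (B ix.1).effect ix.2 s)}

/-- The minimal simulation number of a set `𝓐` of observables: the least `n` such that there are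
observables `B 0, …, B (n - 1)` from which every element of `𝓐` can be simulated, and `⊤` if there
is no such `n`. -/
noncomputable def minSimulationNumber {V : Type*} [AddCommGroup V] [Module ℝ V] {S : Set V}
    (𝓐 : Set (Observable S)) : ℕ∞ :=
  ⨅ (n : ℕ) (_ : ∃ B : Fin n → Observable S, 𝓐 ⊆ simulable (Set.range B)), (n : ℕ∞)

/-- The `k`-th vertex of the regular `n`-gon in the plane `z = 1` of `ℝ³`. -/
noncomputable def polygonVertex (n k : ℕ) : Fin 3 → ℝ :=
  ![(Real.cos (Real.pi / n))⁻¹ * Real.cos (2 * k * Real.pi / n),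
    (Real.cos (Real.pi / n))⁻¹ * Real.sin (2 * k * Real.pi / n),
    1]

/-- The regular polygon state space with `n` vertices. -/
def polygonStateSpace (n : ℕ) : Set (Fin 3 → ℝ) :=
  convexHull ℝ (polygonVertex n '' Set.Icc 1 n)

end GPT

/-!
The number of observables needed to simulate all observables is the number of vertices of a
polytope, and for the regular `2 * m`-gon these vertices can be listed.

Suppose that the extreme rays of the cone of nonnegative affine functions on a state space are
spanned by finitely many functions `F i` (`GPT.IndecomposableFamily`), and let `P` be the polytope
of the weights `w ≥ 0` with `∑ i, w i * F i = 1`; every `w` in `P` is an observable with the effects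
`w i * F i`. Decomposing the effects of an arbitrary observable `A` into the `F i` shows that `A` is
a post-processing of the observable of some `w` in `P`, and `w` is a mixture of vertices of `P` by
Krein-Milman, so the observables of the vertices simulate everything
(`GPT.IndecomposableFamily.mem_simulable`). Conversely, if the observable of a vertex `w` is
simulated by some observables, then an observable `C` used with positive probability has, by
indecomposability, only effects proportional to some `F i` with `w i ≠ 0`
(`GPT.IndecomposableFamily.exists_refines`). As a vertex is the only point of `P` supported in its
support, `C` determines `w` (`GPT.IndecomposableFamily.eq_of_refines`), and different vertices need
different observables. Thus the minimal simulation number of all observables is the number of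
vertices of `P` (`GPT.IndecomposableFamily.minSimulationNumber_univ`).

For the polygon, `F k` is the affine function vanishing on the `k`-th edge (`GPT.edgeFamily`), and
`P` consists of the probability weights for which the weighted sum of the edge normals vanishes.
Weights not supported in a half-plane charge two opposite normals or three normals at the vertices
of an acute triangle (`GPT.exists_support`), and such a pair or triple carries exactly one element
of `P`. So the vertices of `P` are the `m` pairs of opposite edges together with the acute triangles
with vertices among those of a regular `2 * m`-gon
(`GPT.extremePoints_weights_edgeFamily`), and there are `m * (m - 1) * (m - 2) / 3` of the latter
(`GPT.ncard_acuteTriples`).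
-/

namespace GPT

/-! ### State spaces whose cone of effects is generated by finitely many indecomposable effects -/

section Abstract

variable {V : Type*} [AddCommGroup V] [Module ℝ V] {S : Set V} {ι : Type} [Fintype ι]

/-- A finite family of nonnegative affine functions on `S` that represents, once each, the extreme
rays of the cone of nonnegative affine functions: every effect is a nonnegative combination of the
family, an effect dominated by a multiple of a member is proportional to it, and distinct members
are not proportional. The family is not normalized to have values in `[0, 1]`, and it is required
to be positive at a common state `center`. -/
structure IndecomposableFamily (S : Set V) (ι : Type) [Fintype ι] where
  toFun : ι → S → ℝ
  center : S
  affine : ∀ i (s t r : S) (p : ℝ), 0 ≤ p → p ≤ 1 → (r : V) = p • (s : V) + (1 - p) • (t : V) →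
    toFun i r = p * toFun i s + (1 - p) * toFun i t
  nonneg : ∀ i s, 0 ≤ toFun i s
  center_pos : ∀ i, 0 < toFun i center
  generates : ∀ E : Effect S, ∃ c : ι → ℝ, (∀ i, 0 ≤ c i) ∧ ∀ s, E s = ∑ i, c i * toFun i s
  extremal : ∀ (E : Effect S) (i : ι) (t : ℝ), (∀ s, E s ≤ t * toFun i s) →
    ∃ c : ℝ, ∀ s, E s = c * toFun i s
  not_proportional : ∀ (i j : ι) (c d : ℝ), c ≠ 0 → (∀ s, c * toFun i s = d * toFun j s) → i = j

namespace IndecomposableFamily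

variable (F : IndecomposableFamily S ι)

/-- The polytope of all weights `w` for which the functions `w i * F i` form an observable. -/
def weights : Set (ι → ℝ) :=
  {w | (∀ i, 0 ≤ w i) ∧ ∀ s, ∑ i, w i * F.toFun i s = 1}

lemma convex_weights : Convex ℝ F.weights := by
  rintro x ⟨hx, hx1⟩ y ⟨hy, hy1⟩ a b ha hb hab
  refine ⟨fun i => ?_, fun s => ?_⟩
  · have := hx i
    have := hy i
    simp only [Pi.add_apply, Pi.smul_apply, smul_eq_mul]
    positivity
  · simp only [Pi.add_apply, Pi.smul_apply, smul_eq_mul, add_mul, mul_assoc,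
      Finset.sum_add_distrib, ← Finset.mul_sum, hx1, hy1]
    linarith

lemma isCompact_weights : IsCompact F.weights := by
  refine (isCompact_Icc (a := (0 : ι → ℝ))
    (b := fun i => (F.toFun i F.center)⁻¹)).of_isClosed_subset ?_ ?_
  · refine IsClosed.inter (s₁ := {w : ι → ℝ | ∀ i, 0 ≤ w i})
      (s₂ := {w : ι → ℝ | ∀ s, ∑ i, w i * F.toFun i s = 1}) ?_ ?_
    · simp only [Set.ofPred_forall]
      exact isClosed_iInter fun i => isClosed_le (by fun_prop) (by fun_prop)
    · simp only [Set.ofPred_forall]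
      exact isClosed_iInter fun i => isClosed_eq (by fun_prop) (by fun_prop)
  · rintro w ⟨hw, hw1⟩
    refine ⟨fun i => hw i, fun i => ?_⟩
    have h := Finset.single_le_sum (f := fun i => w i * F.toFun i F.center)
      (fun i _ => mul_nonneg (hw i) (F.nonneg i _)) (Finset.mem_univ i)
    simp only [hw1] at h
    rwa [← le_div_iff₀ (F.center_pos i), one_div] at h

/-- The vertices of the polytope of weights are the points which are determined by their
support. -/
lemma mem_extremePoints_weights_iff (w : ι → ℝ) :
    w ∈ F.weights.extremePoints ℝ ↔
      w ∈ F.weights ∧ ∀ v ∈ F.weights, (∀ i, w i = 0 → v i = 0) → v = w := by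
  rw [mem_extremePoints]
  refine and_congr_right fun hw => ⟨fun h v hv hvw => ?_, fun h x hx y hy hxy => ?_⟩
  · -- for small `ε > 0` the weights `w ± ε (v - w)` are nonnegative, and `w` is their midpoint
    have hε : ∀ᶠ ε : ℝ in nhdsWithin 0 (Set.Ioi 0), ∀ i, 0 ≤ w i - ε * (v i - w i) := by
      rw [Filter.eventually_all]
      intro i
      rcases (hw.1 i).eq_or_lt with h0 | h0
      · exact Filter.Eventually.of_forall fun ε => by simp [← h0, hvw i h0.symm]
      · have hc : ContinuousAt (fun ε : ℝ => w i - ε * (v i - w i)) 0 := by fun_prop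
        have := hc.eventually (lt_mem_nhds (show 0 < w i - 0 * (v i - w i) by simpa using h0))
        exact (this.filter_mono nhdsWithin_le_nhds).mono fun _ h => h.le
    have h1 : ∀ᶠ ε : ℝ in nhdsWithin 0 (Set.Ioi 0), ε < 1 :=
      (gt_mem_nhds one_pos).filter_mono nhdsWithin_le_nhds
    obtain ⟨ε, hε, hε1, hε0⟩ := (hε.and (h1.and self_mem_nhdsWithin)).exists
    have hε0 : 0 < ε := hε0
    have hx : (fun i => w i + ε * (v i - w i)) ∈ F.weights := by
      have := F.convex_weights hw hv (sub_nonneg.2 hε1.le) hε0.le (by ring)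
      convert this using 1
      ext i
      simp only [Pi.add_apply, Pi.smul_apply, smul_eq_mul]
      ring
    have hy : (fun i => w i - ε * (v i - w i)) ∈ F.weights := by
      refine ⟨hε, fun s => ?_⟩
      have e : ∀ i, (w i - ε * (v i - w i)) * F.toFun i s
          = (1 + ε) * (w i * F.toFun i s) - ε * (v i * F.toFun i s) := fun i => by ring
      simp only [e, Finset.sum_sub_distrib, ← Finset.mul_sum, hw.2, hv.2]
      ring
    have := (h _ hx _ hy ⟨1 / 2, 1 / 2, by norm_num, by norm_num, by norm_num, by
      ext i
      simp only [Pi.add_apply, Pi.smul_apply, smul_eq_mul]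
      ring⟩).1
    ext i
    have hi := congrFun this i
    simp only [add_eq_left, mul_eq_zero, hε0.ne', false_or] at hi
    linarith
  · have key : ∀ x ∈ F.weights, ∀ y ∈ F.weights, w ∈ openSegment ℝ x y → x = w := by
      rintro x hx y hy ⟨a, b, ha, hb, hab, rfl⟩
      refine h x hx fun i hi => ?_
      simp only [Pi.add_apply, Pi.smul_apply, smul_eq_mul] at hi
      have h1 := mul_nonneg ha.le (hx.1 i)
      have h2 := mul_nonneg hb.le (hy.1 i)
      have : a * x i = 0 := by linarith
      simpa [ha.ne'] using this
    exact ⟨key x hx y hy hxy, key y hy x hx (openSegment_symm ℝ x y ▸ hxy)⟩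

lemma finite_extremePoints_weights : (F.weights.extremePoints ℝ).Finite := by
  refine Set.Finite.of_injOn (f := fun w : ι → ℝ => {i | w i = 0}) (t := Set.univ)
    (fun _ _ => Set.mem_univ _) (fun w hw v hv h => ?_) Set.finite_univ
  rw [mem_extremePoints_weights_iff] at hw hv
  exact hv.2 w hw.1 fun i hi => (Set.ext_iff.1 h i).2 hi

lemma convexHull_extremePoints_weights :
    convexHull ℝ (F.weights.extremePoints ℝ) = F.weights := by
  rw [← (F.finite_extremePoints_weights.isClosed_convexHull ℝ).closure_eq]
  exact closure_convexHull_extremePoints F.isCompact_weights F.convex_weights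

/-- The observable with effects `w i * F i`. -/
def toObservable (w : ι → ℝ) (hw : w ∈ F.weights) : Observable S where
  Outcome := ι
  effect i :=
    { toFun := fun s => w i * F.toFun i s
      affine' := fun s t r p h0 h1 h => by rw [F.affine i s t r p h0 h1 h]; ring
      nonneg' := fun s => mul_nonneg (hw.1 i) (F.nonneg i s)
      le_one' := fun s => by
        rw [← hw.2 s]
        exact Finset.single_le_sum (f := fun i => w i * F.toFun i s)
          (fun i _ => mul_nonneg (hw.1 i) (F.nonneg i s)) (Finset.mem_univ i) }
  sum_effect := hw.2

/-- The observables given by the vertices of the polytope of weights simulate every observable: an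
observable is a post-processing of the observable of its total weights, which is a mixture of those
of the vertices. -/
lemma mem_simulable (A : Observable S) :
    A ∈ simulable (Set.range fun w : F.weights.extremePoints ℝ => F.toObservable w.1 w.2.1) := by
  classical
  choose c hc0 hc using fun y => F.generates (A.effect y)
  set w : ι → ℝ := fun i => ∑ y, c y i with hwdef
  have hw : w ∈ F.weights := by
    refine ⟨fun i => Finset.sum_nonneg fun y _ => hc0 y i, fun s => ?_⟩
    rw [← A.sum_effect s]
    simp only [hc, hwdef, Finset.sum_mul]
    exact Finset.sum_comm
  have hmem := hw
  rw [← F.convexHull_extremePoints_weights, mem_convexHull_iff_exists_fintype] at hmem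
  obtain ⟨κ, _, p, z, hp0, hp1, hz, hpz⟩ := hmem
  have hne : Nonempty A.Outcome := by
    by_contra h
    rw [not_nonempty_iff] at h
    have := A.sum_effect F.center
    simp at this
  obtain ⟨y₀⟩ := hne
  let e := (Fintype.equivFin κ).symm
  let B : Fin (Fintype.card κ) → Observable S := fun t => F.toObservable (z (e t)) (hz (e t)).1
  -- the channel forgets the label of the vertex and distributes `i` in the proportions `c y i`
  refine ⟨Fintype.card κ, B, p ∘ e,
    fun ti y => if w ti.2 = 0 then Pi.single (M := fun _ => ℝ) y₀ 1 y else c y ti.2 / w ti.2,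
    fun t => ⟨⟨z (e t), hz (e t)⟩, rfl⟩, ⟨fun t => hp0 _, ?_⟩, fun ti => ⟨fun y => ?_, ?_⟩,
    fun y s => ?_⟩
  · rw [← hp1]
    exact Equiv.sum_comp e p
  · dsimp only
    split_ifs
    · by_cases h : y = y₀
      · subst h; simp
      · simp [h]
    · exact div_nonneg (hc0 _ _) (hw.1 _)
  · by_cases h : w ti.2 = 0
    · simp [h]
    · simp only [h, if_false, ← Finset.sum_div]
      exact div_self h
  · rw [hc, Fintype.sum_sigma]
    have hwi : ∀ i, w i = ∑ t, p t * z t i := fun i => by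
      rw [← hpz]
      simp [Finset.sum_apply]
    have hcw : ∀ i, w i = 0 → c y i = 0 := fun i hi =>
      (Finset.sum_eq_zero_iff_of_nonneg fun y _ => hc0 y i).1 hi y (Finset.mem_univ y)
    change _ = ∑ t, ∑ i : ι, (if w i = 0 then Pi.single (M := fun _ => ℝ) y₀ 1 y else c y i / w i) *
      (p (e t) * (z (e t) i * F.toFun i s))
    rw [Equiv.sum_comp e (fun t => ∑ i : ι, (if w i = 0 then Pi.single (M := fun _ => ℝ) y₀ 1 y
      else c y i / w i) * (p t * (z t i * F.toFun i s))), Finset.sum_comm]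
    refine Finset.sum_congr rfl fun i _ => ?_
    have : ∑ t, p t * (z t i * F.toFun i s) = w i * F.toFun i s := by
      rw [hwi, Finset.sum_mul]
      exact Finset.sum_congr rfl fun t _ => by ring
    rw [← Finset.mul_sum, this]
    split_ifs with h
    · simp [h, hcw i h]
    · field_simp

/-- Every effect of `C` is a multiple, possibly zero, of a member of the family in the support of
`w`. -/
def Refines (C : Observable S) (w : ι → ℝ) : Prop :=
  ∀ x, ∃ i, ∃ c : ℝ, w i ≠ 0 ∧ ∀ s, C.effect x s = c * F.toFun i s

/-- By indecomposability, each effect of an observable that takes part in a simulation of the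
observable of `w` is proportional to a member of the family in the support of `w`. -/
lemma exists_refines {𝓑 : Set (Observable S)} (w : ι → ℝ) (hw : w ∈ F.weights)
    (h : F.toObservable w hw ∈ simulable 𝓑) : ∃ C ∈ 𝓑, F.Refines C w := by
  obtain ⟨n, B, p, ν, hB, hp, hν, hsim⟩ := h
  obtain ⟨t, ht⟩ : ∃ t, p t ≠ 0 := by
    by_contra! h
    simpa [h] using hp.2
  obtain ⟨i₀, hi₀⟩ : ∃ i, w i ≠ 0 := by
    by_contra! h
    simpa [h] using hw.2 F.center
  have hpt : 0 < p t := (hp.1 t).lt_of_ne' ht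
  refine ⟨B t, hB t, fun x => ?_⟩
  obtain ⟨i, hi⟩ : ∃ i : ι, ν ⟨t, x⟩ i ≠ 0 := by
    by_contra! h
    have := (hν ⟨t, x⟩).2
    exact zero_ne_one ((Finset.sum_eq_zero fun i _ => h i).symm.trans this)
  have hνi : 0 < ν ⟨t, x⟩ i := ((hν ⟨t, x⟩).1 i).lt_of_ne' hi
  have hle : ∀ s, ν ⟨t, x⟩ i * (p t * (B t).effect x s) ≤ w i * F.toFun i s := fun s => by
    have h1 : w i * F.toFun i s = _ := hsim i s
    rw [h1]
    exact Finset.single_le_sum (f := fun ix : Σ i, (B i).Outcome =>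
      ν ix i * (p ix.1 * (B ix.1).effect ix.2 s)) (fun ix _ => mul_nonneg ((hν ix).1 i)
      (mul_nonneg (hp.1 _) (((B ix.1).effect ix.2).nonneg' s)))
      (Finset.mem_univ (⟨t, x⟩ : Σ i, (B i).Outcome))
  have hle' : ∀ s, (B t).effect x s ≤ (w i / (ν ⟨t, x⟩ i * p t)) * F.toFun i s := fun s => by
    rw [div_mul_eq_mul_div, le_div_iff₀ (by positivity)]
    linarith [hle s]
  obtain ⟨c, hc⟩ := F.extremal _ i _ hle'
  by_cases hwi : w i = 0
  · refine ⟨i₀, 0, hi₀, fun s => ?_⟩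
    have h1 := hle' s
    rw [hwi] at h1
    simp only [zero_div, zero_mul] at h1 ⊢
    exact le_antisymm h1 (((B t).effect x).nonneg' s)
  · exact ⟨i, c, hwi, hc⟩

/-- An observable takes part in the simulation of at most one vertex. -/
lemma eq_of_refines (C : Observable S) {w v : ι → ℝ} (hw : w ∈ F.weights.extremePoints ℝ)
    (hv : v ∈ F.weights.extremePoints ℝ) (hCw : F.Refines C w) (hCv : F.Refines C v) : w = v := by
  classical
  rw [mem_extremePoints_weights_iff] at hw hv
  choose a c hwa hc using hCw
  choose b d hvb hd using hCv
  -- the weights `u` of `C` itself are supported in both supports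
  set u : ι → ℝ := fun i => ∑ x, if a x = i then c x else 0 with hu
  have hc0 : ∀ x, 0 ≤ c x := fun x => by
    have h1 := (C.effect x).nonneg' F.center
    rw [hc] at h1
    exact nonneg_of_mul_nonneg_left h1 (F.center_pos _)
  have huP : u ∈ F.weights := by
    refine ⟨fun i => Finset.sum_nonneg fun x _ => by split_ifs <;> simp [hc0], fun s => ?_⟩
    rw [← C.sum_effect s]
    simp only [hu, Finset.sum_mul]
    rw [Finset.sum_comm]
    refine Finset.sum_congr rfl fun x _ => ?_
    simp [hc, ite_mul]
  have key : ∀ i, u i ≠ 0 → ∃ x, a x = i ∧ c x ≠ 0 := fun i hi => by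
    obtain ⟨x, -, hx⟩ := Finset.exists_ne_zero_of_sum_ne_zero hi
    by_cases h : a x = i
    · exact ⟨x, h, by simpa [h] using hx⟩
    · simp [h] at hx
  have h1 : u = w := hw.2 u huP fun i hi => by
    by_contra hne
    obtain ⟨x, rfl, -⟩ := key i hne
    exact hwa x hi
  have h2 : u = v := hv.2 u huP fun i hi => by
    by_contra hne
    obtain ⟨x, rfl, hx⟩ := key i hne
    have := F.not_proportional (a x) (b x) (c x) (d x) hx fun s => by rw [← hc, ← hd]
    exact hvb x (this ▸ hi)
  exact h1.symm.trans h2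

/-- The minimal simulation number of the set of all observables is the number of vertices of the
polytope of weights. -/
theorem minSimulationNumber_univ :
    minSimulationNumber (Set.univ : Set (Observable S))
      = ((F.weights.extremePoints ℝ).ncard : ℕ∞) := by
  have hfin := F.finite_extremePoints_weights
  have := hfin.fintype
  refine le_antisymm (iInf₂_le _ ?_) (le_iInf₂ fun n hn => ?_)
  · let e := (Finite.equivFinOfCardEq
      (Nat.card_coe_set_eq (F.weights.extremePoints ℝ))).symm
    refine ⟨fun t => F.toObservable (e t).1 (e t).2.1, fun A _ => ?_⟩
    have := F.mem_simulable A
    rwa [← e.surjective.range_comp] at this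
  · obtain ⟨B, hB⟩ := hn
    have h : ∀ w : F.weights.extremePoints ℝ, ∃ j, F.Refines (B j) w := fun w => by
      obtain ⟨_, ⟨j, rfl⟩, h⟩ := F.exists_refines w.1 w.2.1 (hB (Set.mem_univ _))
      exact ⟨j, h⟩
    choose j hj using h
    have hinj : Function.Injective j := fun w v h =>
      Subtype.ext (F.eq_of_refines (B (j w)) w.2 v.2 (hj w) (h ▸ hj v))
    have := Nat.card_le_card_of_injective j hinj
    rw [Nat.card_coe_set_eq, Nat.card_fin] at this
    exact_mod_cast this

end IndecomposableFamily

end Abstract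

/-! ### The regular polygon with an even number of vertices -/

section Polygon

open Real

variable {m : ℕ}

/-- The angle of the outer normal of the edge of the regular `2 * m`-gon that joins the vertices
`k` and `k + 1`. -/
noncomputable def edgeAngle (m k : ℕ) : ℝ := (2 * k + 1) * (π / (2 * m))

/-- A linear form which, up to scale, is the indecomposable effect vanishing on the edge between
the vertices `k` and `k + 1`. -/
noncomputable def edgeForm (m k : ℕ) (v : Fin 3 → ℝ) : ℝ :=
  1 - cos (edgeAngle m k) * v 0 - sin (edgeAngle m k) * v 1

lemma cos_halfAngle_pos (hm : 2 ≤ m) : 0 < cos (π / (2 * m)) := by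
  have hm' : (2 : ℝ) ≤ m := by exact_mod_cast hm
  refine cos_pos_of_mem_Ioo ⟨?_, ?_⟩
  · have : 0 < π / (2 * m) := by positivity
    linarith [pi_pos]
  · rw [div_lt_div_iff₀ (by positivity) two_pos]
    nlinarith [pi_pos]

lemma sin_halfAngle_pos (hm : 2 ≤ m) : 0 < sin (π / (2 * m)) := by
  have hm' : (2 : ℝ) ≤ m := by exact_mod_cast hm
  refine sin_pos_of_pos_of_lt_pi (by positivity) ?_
  rw [div_lt_iff₀ (by positivity)]
  nlinarith [pi_pos]

lemma polygonVertex_eq (m k : ℕ) :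
    polygonVertex (2 * m) k = ![(cos (π / (2 * m)))⁻¹ * cos (2 * k * (π / (2 * m))),
      (cos (π / (2 * m)))⁻¹ * sin (2 * k * (π / (2 * m))), 1] := by
  simp only [polygonVertex, Nat.cast_mul, Nat.cast_ofNat, mul_div_assoc]

lemma convex_polygonStateSpace (n : ℕ) : Convex ℝ (polygonStateSpace n) := convex_convexHull ℝ _

lemma polygonVertex_add_half (hm : 2 ≤ m) (k : ℕ) :
    polygonVertex (2 * m) (k + m) = ![-polygonVertex (2 * m) k 0, -polygonVertex (2 * m) k 1, 1] := by
  have hm' : (m : ℝ) ≠ 0 := by positivity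
  have : 2 * ((k + m : ℕ) : ℝ) * (π / (2 * m)) = 2 * k * (π / (2 * m)) + π := by
    push_cast
    field_simp
  rw [polygonVertex_eq m (k + m), polygonVertex_eq m k, this, cos_add_pi, sin_add_pi]
  simp

lemma polygonVertex_add_period (hm : 2 ≤ m) (k : ℕ) :
    polygonVertex (2 * m) (k + 2 * m) = polygonVertex (2 * m) k := by
  rw [two_mul m, ← add_assoc, ← two_mul, polygonVertex_add_half hm, polygonVertex_add_half hm]
  ext i
  fin_cases i <;> simp [polygonVertex]

lemma edgeAngle_add_half (hm : 2 ≤ m) (i : ℕ) : edgeAngle m (i + m) = edgeAngle m i + π := by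
  have hm' : (m : ℝ) ≠ 0 := by positivity
  simp only [edgeAngle]
  push_cast
  field_simp
  ring

lemma edgeForm_add_period (hm : 2 ≤ m) (k : ℕ) : edgeForm m (k + 2 * m) = edgeForm m k := by
  have : edgeAngle m (k + 2 * m) = edgeAngle m k + 2 * π := by
    rw [two_mul, ← add_assoc, edgeAngle_add_half hm, edgeAngle_add_half hm]
    ring
  ext v
  simp only [edgeForm, this, cos_add_two_pi, sin_add_two_pi]

lemma polygonVertex_mem (hm : 2 ≤ m) (k : ℕ) :
    polygonVertex (2 * m) k ∈ polygonStateSpace (2 * m) := by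
  have hper : Function.Periodic (polygonVertex (2 * m)) (2 * m) := polygonVertex_add_period hm
  rw [← hper.map_mod_nat, ← hper]
  by_cases h : k % (2 * m) = 0
  · exact subset_convexHull _ _ ⟨2 * m, ⟨by omega, le_rfl⟩, by rw [h, zero_add]⟩
  · rw [hper]
    exact subset_convexHull _ _
      ⟨_, ⟨Nat.pos_of_ne_zero h, (Nat.mod_lt _ (by omega)).le⟩, rfl⟩

/-- The polygon is symmetric about its centre, so it contains the diagonal through a vertex. -/
lemma smul_vertex_mem (hm : 2 ≤ m) (k : ℕ) {t : ℝ} (ht : -1 ≤ t) (ht' : t ≤ 1) :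
    ![t * polygonVertex (2 * m) k 0, t * polygonVertex (2 * m) k 1, 1]
      ∈ polygonStateSpace (2 * m) := by
  have := (convex_polygonStateSpace (2 * m)) (polygonVertex_mem hm k) (polygonVertex_mem hm (k + m))
    (show 0 ≤ (1 + t) / 2 by linarith) (show 0 ≤ (1 - t) / 2 by linarith) (by ring)
  convert this using 1
  rw [polygonVertex_add_half hm]
  ext i
  fin_cases i <;> simp [polygonVertex] <;> ring

lemma center_mem (hm : 2 ≤ m) : ![0, 0, 1] ∈ polygonStateSpace (2 * m) := by
  simpa using smul_vertex_mem hm 0 (t := 0) (by norm_num) (by norm_num)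

lemma Effect.apply_smul_vertex (hm : 2 ≤ m) (E : Effect (polygonStateSpace (2 * m))) (k : ℕ)
    {t : ℝ} (ht : -1 ≤ t) (ht' : t ≤ 1) :
    E ⟨_, smul_vertex_mem hm k ht ht'⟩ = E ⟨_, center_mem hm⟩ +
      t * (E ⟨_, polygonVertex_mem hm k⟩ - E ⟨_, center_mem hm⟩) := by
  have h1 := E.affine' ⟨_, polygonVertex_mem hm k⟩ ⟨_, polygonVertex_mem hm (k + m)⟩
    ⟨_, smul_vertex_mem hm k ht ht'⟩ ((1 + t) / 2) (by linarith) (by linarith) (by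
      simp only [polygonVertex_add_half hm]
      ext i
      fin_cases i <;> simp [polygonVertex] <;> ring)
  have h2 := E.affine' ⟨_, polygonVertex_mem hm k⟩ ⟨_, polygonVertex_mem hm (k + m)⟩
    ⟨_, center_mem hm⟩ (1 / 2) (by norm_num) (by norm_num) (by
      simp only [polygonVertex_add_half hm]
      ext i
      fin_cases i <;> simp [polygonVertex] <;> ring)
  rw [h1]
  linear_combination (t - 1) * h2

lemma polygonStateSpace_apply_two {n : ℕ} {v : Fin 3 → ℝ} (hv : v ∈ polygonStateSpace n) :
    v 2 = 1 := by
  have : polygonStateSpace n ⊆ {v | v 2 = 1} := by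
    refine convexHull_min ?_ ?_
    · rintro _ ⟨k, -, rfl⟩
      simp [polygonVertex]
    · intro x hx y hy a b _ _ hab
      simp only [Set.mem_ofPred_eq] at hx hy ⊢
      simp [hx, hy, hab]
  exact this hv

/-- Every effect is the restriction of an affine function of the plane: it is determined by its
values at the centre and at the linearly independent vertices `0` and `1`, since a contraction of
the polygon towards its centre is contained in the parallelogram spanned by these vertices and their
antipodes. -/
lemma Effect.exists_affine (hm : 2 ≤ m) (E : Effect (polygonStateSpace (2 * m))) :
    ∃ A B C : ℝ, ∀ s : polygonStateSpace (2 * m), E s = A * s.1 0 + B * s.1 1 + C := by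
  have hc := cos_halfAngle_pos hm
  have hs := sin_halfAngle_pos hm
  set o := E ⟨_, center_mem hm⟩
  set D₀ := E ⟨_, polygonVertex_mem hm 0⟩ - o
  set D₁ := E ⟨_, polygonVertex_mem hm 1⟩ - o
  set x₀ := polygonVertex (2 * m) 0 0 with hx₀
  have hy₀ : polygonVertex (2 * m) 0 1 = 0 := by simp [polygonVertex]
  set x₁ := polygonVertex (2 * m) 1 0
  set y₁ := polygonVertex (2 * m) 1 1 with hy₁
  have hx₀' : x₀ ≠ 0 := by
    simp [hx₀, polygonVertex_eq, hc.ne']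
  have hy₁' : y₁ ≠ 0 := by
    simp [hy₁, polygonVertex_eq, sin_two_mul, hc.ne', hs.ne']
  refine ⟨D₀ / x₀, (D₁ - D₀ * x₁ / x₀) / y₁, o, fun s => ?_⟩
  set β := s.1 1 / y₁ with hβ
  set α := (s.1 0 - β * x₁) / x₀ with hα
  set ε := 1 / (2 * (1 + |α| + |β|)) with hε
  have hM : 0 < 1 + |α| + |β| := by positivity
  have hε0 : 0 < ε := by positivity
  have hε1 : ε ≤ 1 := by
    rw [hε, div_le_one (by positivity)]
    linarith [abs_nonneg α, abs_nonneg β]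
  have habs : ∀ γ : ℝ, |γ| ≤ |α| + |β| → -1 ≤ 2 * ε * γ ∧ 2 * ε * γ ≤ 1 := fun γ hγ => by
    rw [← abs_le, abs_mul, abs_of_pos (by positivity), hε]
    field_simp
    linarith
  obtain ⟨h1, h2⟩ := habs α (by linarith [abs_nonneg β])
  obtain ⟨h3, h4⟩ := habs β (by linarith [abs_nonneg α])
  have hr : ![ε * s.1 0, ε * s.1 1, 1] ∈ polygonStateSpace (2 * m) := by
    have := (convex_polygonStateSpace (2 * m)) s.2 (center_mem hm) hε0.le
      (sub_nonneg.2 hε1) (by ring)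
    convert this using 1
    have := polygonStateSpace_apply_two s.2
    ext i
    fin_cases i <;> simp [this]
  have e1 := E.affine' s ⟨_, center_mem hm⟩ ⟨_, hr⟩ ε hε0.le hε1 (by
    have := polygonStateSpace_apply_two s.2
    ext i
    fin_cases i <;> simp [this])
  have hsx : s.1 0 = α * x₀ + β * x₁ := by
    rw [hα]; field_simp; ring
  have hsy : s.1 1 = β * y₁ := by
    rw [hβ]; field_simp
  have e2 := E.affine' ⟨_, smul_vertex_mem hm 0 h1 h2⟩ ⟨_, smul_vertex_mem hm 1 h3 h4⟩ ⟨_, hr⟩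
    (1 / 2) (by norm_num) (by norm_num) (by
      ext i
      fin_cases i
      · change ε * s.1 0 = 1 / 2 * (2 * ε * α * x₀) + (1 - 1 / 2) * (2 * ε * β * x₁)
        rw [hsx]; ring
      · change ε * s.1 1 = 1 / 2 * (2 * ε * α * polygonVertex (2 * m) 0 1)
          + (1 - 1 / 2) * (2 * ε * β * y₁)
        rw [hsy, hy₀]; ring
      · change (1 : ℝ) = 1 / 2 * 1 + (1 - 1 / 2) * 1
        norm_num)
  rw [E.apply_smul_vertex hm 0 h1 h2, E.apply_smul_vertex hm 1 h3 h4, e1] at e2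
  have e3 : ε * (E s - (o + α * D₀ + β * D₁)) = 0 := by
    linear_combination e2
  have e4 : E s = o + α * D₀ + β * D₁ := by
    rcases mul_eq_zero.1 e3 with h | h
    · exact absurd h hε0.ne'
    · linarith
  rw [e4, hsx, hsy]
  field_simp
  ring

/-- An affine function vanishing on the polygon is zero. -/
lemma coeff_eq_zero_of_forall (hm : 2 ≤ m) {A B C : ℝ}
    (h : ∀ s : polygonStateSpace (2 * m), A * s.1 0 + B * s.1 1 + C = 0) :
    A = 0 ∧ B = 0 ∧ C = 0 := by
  have hc := cos_halfAngle_pos hm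
  have hs := sin_halfAngle_pos hm
  have h0 := h ⟨_, center_mem hm⟩
  have h1 := h ⟨_, polygonVertex_mem hm 0⟩
  have h2 := h ⟨_, polygonVertex_mem hm 1⟩
  simp only [polygonVertex_eq, Matrix.cons_val_zero, Matrix.cons_val_one, mul_zero, zero_add,
    Nat.cast_zero, zero_mul, cos_zero, sin_zero, mul_one, add_zero, Nat.cast_one] at h0 h1 h2
  subst h0
  have hA : A = 0 := by simpa [hc.ne'] using h1
  subst hA
  simpa [sin_two_mul, hc.ne', hs.ne'] using h2

lemma edgeForm_nonneg (hm : 2 ≤ m) {k : ℕ} (hk : k < 2 * m) (v : Fin 3 → ℝ)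
    (hv : v ∈ polygonStateSpace (2 * m)) : 0 ≤ edgeForm m k v := by
  have hc := cos_halfAngle_pos hm
  have hδ : 0 < π / (2 * m) := by positivity
  have hδm : 2 * m * (π / (2 * m)) = π := by field_simp
  have : polygonStateSpace (2 * m) ⊆ {v | 0 ≤ edgeForm m k v} := by
    refine convexHull_min ?_ ?_
    · rintro _ ⟨l, ⟨hl1, hl2⟩, rfl⟩
      simp only [Set.mem_ofPred_eq, edgeForm, polygonVertex_eq, Matrix.cons_val_zero,
        Matrix.cons_val_one, edgeAngle]
      set δ := π / (2 * m)
      -- the difference is a product of two sines whose arguments lie in the same half-turn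
      have key : 0 ≤ sin ((k - l + 1) * δ) * sin ((k - l) * δ) := by
        rcases le_or_gt l k with h | h
        · have h' : (l : ℝ) ≤ k := by exact_mod_cast h
          have h'' : (k : ℝ) - l + 1 ≤ 2 * m := by
            have : k + 1 ≤ 2 * m + l := by omega
            have : (k : ℝ) + 1 ≤ 2 * m + l := by exact_mod_cast this
            linarith
          refine mul_nonneg (sin_nonneg_of_nonneg_of_le_pi ?_ ?_)
            (sin_nonneg_of_nonneg_of_le_pi ?_ ?_) <;> nlinarith
        · have h' : (k : ℝ) + 1 ≤ l := by exact_mod_cast h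
          have h'' : (l : ℝ) ≤ 2 * m := by exact_mod_cast hl2
          have : (0 : ℝ) ≤ k := by positivity
          refine mul_nonneg_of_nonpos_of_nonpos (sin_nonpos_of_nonpos_of_neg_pi_le ?_ ?_)
            (sin_nonpos_of_nonpos_of_neg_pi_le ?_ ?_) <;> nlinarith
      have e := cos_sub_cos δ ((2 * k + 1) * δ - 2 * l * δ)
      rw [show (δ + ((2 * k + 1) * δ - 2 * l * δ)) / 2 = (k - l + 1) * δ by ring,
        show (δ - ((2 * k + 1) * δ - 2 * l * δ)) / 2 = -((k - l) * δ) by ring, sin_neg,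
        cos_sub ((2 * k + 1) * δ)] at e
      have e' : 1 - cos ((2 * k + 1) * δ) * ((cos δ)⁻¹ * cos (2 * l * δ)) -
          sin ((2 * k + 1) * δ) * ((cos δ)⁻¹ * sin (2 * l * δ)) =
          (cos δ)⁻¹ * (2 * (sin ((k - l + 1) * δ) * sin ((k - l) * δ))) := by
        generalize cos (2 * l * δ) = a at e ⊢
        generalize sin (2 * l * δ) = b at e ⊢
        generalize sin (((k : ℝ) - l + 1) * δ) = p at e ⊢
        generalize sin (((k : ℝ) - l) * δ) = q at e ⊢
        field_simp
        linear_combination e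
      rw [e']
      positivity
    · intro x hx y hy a b ha hb hab
      simp only [Set.mem_ofPred_eq, edgeForm] at hx hy ⊢
      simp only [Pi.add_apply, Pi.smul_apply, smul_eq_mul]
      nlinarith [mul_nonneg ha hx, mul_nonneg hb hy]
  exact this hv

/-- A nonnegative affine function on the polygon is the sum of its minimum, attained at a vertex,
and a nonnegative combination of the forms of the two edges at that vertex. -/
lemma exists_eq_edgeForm_add (hm : 2 ≤ m) (A B C : ℝ)
    (h : ∀ s : polygonStateSpace (2 * m), 0 ≤ A * s.1 0 + B * s.1 1 + C) :
    ∃ (k : ℕ) (α β K : ℝ), 0 ≤ α ∧ 0 ≤ β ∧ 0 ≤ K ∧ ∀ v : Fin 3 → ℝ,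
      A * v 0 + B * v 1 + C = α * edgeForm m k v + β * edgeForm m (k + 1) v + K := by
  have hc := cos_halfAngle_pos hm
  have hs := sin_halfAngle_pos hm
  set g : (Fin 3 → ℝ) → ℝ := fun v => A * v 0 + B * v 1 + C with hg
  obtain ⟨j, hj⟩ : ∃ j, ∀ l, g (polygonVertex (2 * m) (j + 1)) ≤ g (polygonVertex (2 * m) l) := by
    have hper : Function.Periodic (polygonVertex (2 * m)) (2 * m) := polygonVertex_add_period hm
    obtain ⟨i, -, hi⟩ := Finset.exists_min_image (Finset.range (2 * m))
      (fun k => g (polygonVertex (2 * m) k)) ⟨0, Finset.mem_range.2 (by omega)⟩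
    refine ⟨i + 2 * m - 1, fun l => ?_⟩
    rw [Nat.sub_add_cancel (by omega), hper, ← hper.map_mod_nat l]
    exact hi _ (Finset.mem_range.2 (Nat.mod_lt _ (by omega)))
  have h0 := h ⟨_, polygonVertex_mem hm (j + 1)⟩
  have h1 := hj j
  have h2 := hj (j + 2)
  simp only [hg, polygonVertex_eq, Matrix.cons_val_zero, Matrix.cons_val_one] at h0 h1 h2
  set δ := π / (2 * m)
  set σ := cos δ
  set τ := sin δ
  have hpy : τ ^ 2 + σ ^ 2 = 1 := sin_sq_add_cos_sq δ
  set c := cos (2 * ((j + 1 : ℕ) : ℝ) * δ)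
  set d := sin (2 * ((j + 1 : ℕ) : ℝ) * δ)
  have hcd : d ^ 2 + c ^ 2 = 1 := sin_sq_add_cos_sq _
  have c1 : cos (2 * (j : ℝ) * δ) = c * (σ ^ 2 - τ ^ 2) + d * (2 * τ * σ) := by
    rw [show 2 * (j : ℝ) * δ = 2 * ((j + 1 : ℕ) : ℝ) * δ - 2 * δ by push_cast; ring, cos_sub,
      sin_two_mul, cos_two_mul']
  have s1 : sin (2 * (j : ℝ) * δ) = d * (σ ^ 2 - τ ^ 2) - c * (2 * τ * σ) := by
    rw [show 2 * (j : ℝ) * δ = 2 * ((j + 1 : ℕ) : ℝ) * δ - 2 * δ by push_cast; ring, sin_sub,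
      sin_two_mul, cos_two_mul']
  have c2 : cos (2 * ((j + 2 : ℕ) : ℝ) * δ) = c * (σ ^ 2 - τ ^ 2) - d * (2 * τ * σ) := by
    rw [show 2 * ((j + 2 : ℕ) : ℝ) * δ = 2 * ((j + 1 : ℕ) : ℝ) * δ + 2 * δ by push_cast; ring,
      cos_add, sin_two_mul, cos_two_mul']
  have s2 : sin (2 * ((j + 2 : ℕ) : ℝ) * δ) = d * (σ ^ 2 - τ ^ 2) + c * (2 * τ * σ) := by
    rw [show 2 * ((j + 2 : ℕ) : ℝ) * δ = 2 * ((j + 1 : ℕ) : ℝ) * δ + 2 * δ by push_cast; ring,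
      sin_add, sin_two_mul, cos_two_mul']
  have ce1 : cos (edgeAngle m j) = c * σ + d * τ := by
    rw [edgeAngle, show (2 * (j : ℝ) + 1) * δ = 2 * ((j + 1 : ℕ) : ℝ) * δ - δ by push_cast; ring,
      cos_sub]
  have se1 : sin (edgeAngle m j) = d * σ - c * τ := by
    rw [edgeAngle, show (2 * (j : ℝ) + 1) * δ = 2 * ((j + 1 : ℕ) : ℝ) * δ - δ by push_cast; ring,
      sin_sub]
  have ce2 : cos (edgeAngle m (j + 1)) = c * σ - d * τ := by
    rw [edgeAngle, show (2 * ((j + 1 : ℕ) : ℝ) + 1) * δ = 2 * ((j + 1 : ℕ) : ℝ) * δ + δ by ring,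
      cos_add]
  have se2 : sin (edgeAngle m (j + 1)) = d * σ + c * τ := by
    rw [edgeAngle, show (2 * ((j + 1 : ℕ) : ℝ) + 1) * δ = 2 * ((j + 1 : ℕ) : ℝ) * δ + δ by ring,
      sin_add]
  rw [c1, s1] at h1
  rw [c2, s2] at h2
  -- coordinates of `-(A, B)` in the basis of the two edge normals
  refine ⟨j, (B * (c * σ - d * τ) - A * (d * σ + c * τ)) / (2 * τ * σ),
    (A * (d * σ - c * τ) - B * (c * σ + d * τ)) / (2 * τ * σ), _, ?_, ?_, h0, fun v => ?_⟩
  · refine div_nonneg ?_ (by positivity)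
    have e : A * (σ⁻¹ * (c * (σ ^ 2 - τ ^ 2) - d * (2 * τ * σ))) +
        B * (σ⁻¹ * (d * (σ ^ 2 - τ ^ 2) + c * (2 * τ * σ))) - (A * (σ⁻¹ * c) + B * (σ⁻¹ * d))
        = 2 * σ⁻¹ * τ * (B * (c * σ - d * τ) - A * (d * σ + c * τ)) := by
      field_simp
      linear_combination (A * c + B * d) * hpy
    have : 0 ≤ 2 * σ⁻¹ * τ * (B * (c * σ - d * τ) - A * (d * σ + c * τ)) := by linarith
    exact nonneg_of_mul_nonneg_right this (by positivity)
  · refine div_nonneg ?_ (by positivity)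
    have e : A * (σ⁻¹ * (c * (σ ^ 2 - τ ^ 2) + d * (2 * τ * σ))) +
        B * (σ⁻¹ * (d * (σ ^ 2 - τ ^ 2) - c * (2 * τ * σ))) - (A * (σ⁻¹ * c) + B * (σ⁻¹ * d))
        = 2 * σ⁻¹ * τ * (A * (d * σ - c * τ) - B * (c * σ + d * τ)) := by
      field_simp
      linear_combination (A * c + B * d) * hpy
    have : 0 ≤ 2 * σ⁻¹ * τ * (A * (d * σ - c * τ) - B * (c * σ + d * τ)) := by linarith
    exact nonneg_of_mul_nonneg_right this (by positivity)
  · simp only [edgeForm, ce1, se1, ce2, se2]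
    field_simp
    linear_combination -(2 * τ * σ * (A * v 0 + B * v 1)) * hcd

lemma edgeForm_zero_add_half (hm : 2 ≤ m) (v : Fin 3 → ℝ) :
    edgeForm m 0 v + edgeForm m m v = 2 := by
  have : edgeAngle m m = edgeAngle m 0 + π := by
    rw [← edgeAngle_add_half hm, zero_add]
  simp only [edgeForm, this, cos_add_pi, sin_add_pi]
  ring

/-- An effect dominated by a multiple of an edge form vanishes on that edge, hence is proportional
to the form. -/
lemma Effect.eq_smul_edgeForm (hm : 2 ≤ m) (E : Effect (polygonStateSpace (2 * m))) (k : ℕ) (t : ℝ)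
    (h : ∀ s : polygonStateSpace (2 * m), E s ≤ t * edgeForm m k s) :
    ∃ c : ℝ, ∀ s : polygonStateSpace (2 * m), E s = c * edgeForm m k s := by
  have hc := cos_halfAngle_pos hm
  have hs := sin_halfAngle_pos hm
  obtain ⟨A, B, C, hE⟩ := E.exists_affine hm
  have key : ∀ l, edgeForm m k (polygonVertex (2 * m) l) = 0 →
      A * polygonVertex (2 * m) l 0 + B * polygonVertex (2 * m) l 1 + C = 0 := fun l hl => by
    have h1 := h ⟨_, polygonVertex_mem hm l⟩
    have h2 := E.nonneg' ⟨_, polygonVertex_mem hm l⟩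
    rw [hl, mul_zero] at h1
    rw [← hE ⟨_, polygonVertex_mem hm l⟩]
    exact le_antisymm h1 h2
  have h1 := key k
  have h2 := key (k + 1)
  simp only [polygonVertex_eq, edgeForm, Matrix.cons_val_zero, Matrix.cons_val_one] at h1 h2
  set θ := edgeAngle m k with hθ
  set δ := π / (2 * m)
  have hθδ : θ = (2 * k + 1) * δ := rfl
  rw [show 2 * (k : ℝ) * δ = θ - δ by rw [hθδ]; ring, cos_sub, sin_sub] at h1
  rw [show 2 * ((k + 1 : ℕ) : ℝ) * δ = θ + δ by rw [hθδ]; push_cast; ring, cos_add, sin_add] at h2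
  have hθ1 := sin_sq_add_cos_sq θ
  have h1' := h1 (by field_simp; linear_combination (-cos δ) * hθ1)
  have h2' := h2 (by field_simp; linear_combination (-cos δ) * hθ1)
  field_simp at h1' h2'
  have e1 : B * cos θ = A * sin θ := by
    have : sin δ * (B * cos θ - A * sin θ) = 0 := by linear_combination (h2' - h1') / 2
    rcases mul_eq_zero.1 this with h | h
    · exact absurd h hs.ne'
    · linarith
  have e2 : C = -(A * cos θ + B * sin θ) := by
    have : cos δ * (C + (A * cos θ + B * sin θ)) = 0 := by linear_combination (h2' + h1') / 2
    rcases mul_eq_zero.1 this with h | h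
    · exact absurd h hc.ne'
    · linarith
  refine ⟨C, fun s => ?_⟩
  rw [hE, edgeForm, ← hθ, e2]
  linear_combination (-A * s.1 0 - B * s.1 1) * hθ1 + (s.1 1 * cos θ - s.1 0 * sin θ) * e1

lemma edgeAngle_injOn (hm : 2 ≤ m) {i j : ℕ} (hi : i < 2 * m) (hj : j < 2 * m)
    (hc : cos (edgeAngle m i) = cos (edgeAngle m j))
    (hs : sin (edgeAngle m i) = sin (edgeAngle m j)) : i = j := by
  have hm' : (m : ℝ) ≠ 0 := by positivity
  have hδ : 0 < π / (2 * m) := by positivity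
  have hδm : 2 * m * (π / (2 * m)) = π := by field_simp
  have h1 : cos (edgeAngle m i - edgeAngle m j) = 1 := by
    rw [cos_sub, hc, hs]
    linear_combination sin_sq_add_cos_sq (edgeAngle m j)
  have hi' : (i : ℝ) + 1 ≤ 2 * m := by exact_mod_cast hi
  have hj' : (j : ℝ) + 1 ≤ 2 * m := by exact_mod_cast hj
  have hi0 : (0 : ℝ) ≤ i := by positivity
  have hj0 : (0 : ℝ) ≤ j := by positivity
  have hd : edgeAngle m i - edgeAngle m j = 2 * ((i : ℝ) - j) * (π / (2 * m)) := by
    simp only [edgeAngle]; ring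
  rw [cos_eq_one_iff_of_lt_of_lt (by rw [hd]; nlinarith) (by rw [hd]; nlinarith), hd] at h1
  have : (i : ℝ) - j = 0 := by
    simpa [hm', pi_ne_zero] using h1
  exact_mod_cast sub_eq_zero.1 this

/-- The edge forms of the regular `2 * m`-gon. -/
noncomputable def edgeFamily (hm : 2 ≤ m) :
    IndecomposableFamily (polygonStateSpace (2 * m)) (Fin (2 * m)) where
  toFun k s := edgeForm m k s
  center := ⟨_, center_mem hm⟩
  affine i s t r p _ _ h := by
    simp only [edgeForm, h, Pi.add_apply, Pi.smul_apply, smul_eq_mul]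
    ring
  nonneg i s := edgeForm_nonneg hm i.2 s s.2
  center_pos i := by simp [edgeForm]
  generates E := by
    obtain ⟨A, B, C, hE⟩ := E.exists_affine hm
    obtain ⟨k, α, β, K, hα, hβ, hK, h⟩ := exists_eq_edgeForm_add hm A B C fun s => by
      rw [← hE]; exact E.nonneg' s
    have hper : Function.Periodic (edgeForm m) (2 * m) := edgeForm_add_period hm
    have hpos : 0 < 2 * m := by omega
    let i₁ : Fin (2 * m) := ⟨k % (2 * m), Nat.mod_lt _ hpos⟩
    let i₂ : Fin (2 * m) := ⟨(k + 1) % (2 * m), Nat.mod_lt _ hpos⟩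
    let i₃ : Fin (2 * m) := ⟨0, hpos⟩
    let i₄ : Fin (2 * m) := ⟨m, by omega⟩
    -- the constant `K` is half of `K` times the sum of two opposite edge forms
    refine ⟨Pi.single i₁ α + Pi.single i₂ β + Pi.single i₃ (K / 2) + Pi.single i₄ (K / 2), ?_,
      fun s => ?_⟩
    · have h0 : ∀ (i : Fin (2 * m)) {a : ℝ}, 0 ≤ a → 0 ≤ (Pi.single i a : Fin (2 * m) → ℝ) :=
        fun i a ha => Pi.single_nonneg.2 ha
      exact add_nonneg (add_nonneg (add_nonneg (h0 _ hα) (h0 _ hβ)) (h0 _ (by positivity)))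
        (h0 _ (by positivity))
    · rw [hE, h]
      simp only [Pi.add_apply, add_mul, Finset.sum_add_distrib, Pi.single_apply, ite_mul, zero_mul,
        Finset.sum_ite_eq', Finset.mem_univ, if_true]
      simp only [i₁, i₂, i₃, i₄, hper.map_mod_nat]
      linear_combination (-K / 2) * edgeForm_zero_add_half hm s
  extremal E i t h := E.eq_smul_edgeForm hm i t h
  not_proportional i j c d hc h := by
    have h1 : ∀ s : polygonStateSpace (2 * m),
        (d * cos (edgeAngle m j) - c * cos (edgeAngle m i)) * s.1 0 +
        (d * sin (edgeAngle m j) - c * sin (edgeAngle m i)) * s.1 1 + (c - d) = 0 := fun s => by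
      have := h s
      simp only [edgeForm] at this
      linear_combination this
    obtain ⟨hA, hB, hC⟩ := coeff_eq_zero_of_forall hm h1
    obtain rfl : c = d := by linarith
    rw [← mul_sub, mul_eq_zero, or_iff_right hc] at hA hB
    exact Fin.ext (edgeAngle_injOn hm i.2 j.2 (by linarith) (by linarith))

lemma mem_weights_edgeFamily_iff (hm : 2 ≤ m) (w : Fin (2 * m) → ℝ) :
    w ∈ (edgeFamily hm).weights ↔ (∀ i, 0 ≤ w i) ∧ ∑ i, w i = 1 ∧
      ∑ i, w i * cos (edgeAngle m i) = 0 ∧ ∑ i, w i * sin (edgeAngle m i) = 0 := by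
  refine and_congr_right fun _ => ?_
  have e : ∀ s : polygonStateSpace (2 * m), ∑ i, w i * (edgeFamily hm).toFun i s =
      ∑ i, w i - (∑ i, w i * cos (edgeAngle m i)) * s.1 0
        - (∑ i, w i * sin (edgeAngle m i)) * s.1 1 := fun s => by
    simp only [edgeFamily, edgeForm, mul_sub, mul_one, Finset.sum_sub_distrib, Finset.sum_mul,
      mul_assoc]
  simp only [e]
  refine ⟨fun h => ?_, fun ⟨h1, h2, h3⟩ s => by rw [h1, h2, h3]; ring⟩
  obtain ⟨hA, hB, hC⟩ := coeff_eq_zero_of_forall hm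
    (A := -∑ i, w i * cos (edgeAngle m i)) (B := -∑ i, w i * sin (edgeAngle m i))
    (C := ∑ i, w i - 1) fun s => by linear_combination h s
  exact ⟨by linarith, by linarith, by linarith⟩

end Polygon

/-! ### Counting acute triangles -/

section Count
/-- The increasing triples of residues modulo `2 * m` for which the corresponding points of the
circle are the vertices of an acute triangle: all three gaps are less than a half-turn. -/
def acuteTriples (m : ℕ) : Set (ℕ × ℕ × ℕ) :=
  {t | t.1 < t.2.1 ∧ t.2.1 < t.2.2 ∧ t.2.2 < 2 * m ∧ t.2.1 < t.1 + m ∧ t.2.2 < t.2.1 + m ∧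
    t.1 + m < t.2.2}

lemma sum_range_pred_mul (m : ℕ) :
    ((∑ t ∈ Finset.range m, (t - 1) * t : ℕ) : ℝ) = (m : ℝ) * (m - 1) * (m - 2) / 3 := by
  induction m with
  | zero => simp
  | succ m ih =>
    rw [Finset.sum_range_succ, Nat.cast_add, ih]
    rcases m with _ | m
    · simp
    · push_cast [Nat.add_sub_cancel]
      ring

/-- A triple is determined by `i` and the numbers by which the gap from `i` to `j` and the gap from
`i` to `k` fall short of `m` and `2 * m`. -/
lemma ncard_acuteTriples (m : ℕ) :
    ((acuteTriples m).ncard : ℝ) = (m : ℝ) * (m - 1) * (m - 2) / 3 := by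
  rw [← sum_range_pred_mul]
  congr 1
  have : (acuteTriples m).ncard = ((Finset.range m).sigma fun t =>
      Finset.Ico 1 t ×ˢ Finset.range t).card := by
    rw [← Set.ncard_coe_finset]
    refine Set.ncard_congr (fun x _ => ⟨2 * m - (x.2.2 - x.1), m - (x.2.1 - x.1), x.1⟩) ?_ ?_ ?_
    · rintro ⟨i, j, k⟩ ⟨h1, h2, h3, h4, h5, h6⟩
      simp only [Finset.coe_sigma, Finset.mem_coe, Set.mem_sigma_iff, Finset.mem_range,
        Finset.mem_product, Finset.mem_Ico] at *
      omega
    · rintro ⟨i, j, k⟩ ⟨i', j', k'⟩ ⟨h1, h2, h3, h4, h5, h6⟩ ⟨h1', h2', h3', h4', h5', h6'⟩ h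
      simp only [Sigma.mk.injEq, heq_eq_eq, Prod.mk.injEq] at *
      omega
    · rintro ⟨t, a, i⟩ h
      simp only [Finset.coe_sigma, Finset.mem_coe, Set.mem_sigma_iff, Finset.mem_range,
        Finset.mem_product, Finset.mem_Ico] at h
      refine ⟨⟨i, i + m - a, i + 2 * m - t⟩, ?_, ?_⟩
      · simp only [acuteTriples, Set.mem_ofPred_eq]
        omega
      · simp only [Sigma.mk.injEq, heq_eq_eq, Prod.mk.injEq, and_true]
        omega
  rw [this, Finset.card_sigma]
  simp

end Count

/-! ### The vertices of the polytope of weights of the polygon -/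

section Vertices

open Real

variable {m : ℕ}

lemma sin_edgeAngle_sub (i j : ℕ) :
    sin (edgeAngle m j - edgeAngle m i) = sin (((j : ℝ) - i) * (π / m)) := by
  congr 1
  simp only [edgeAngle]
  field_simp
  ring

lemma sin_edgeAngle_sub_pos {i j : ℕ} (h : i < j) (h' : j < i + m) :
    0 < sin (edgeAngle m j - edgeAngle m i) := by
  have hm : 0 < m := by omega
  have h1 : (i : ℝ) < j := by exact_mod_cast h
  have h2 : (j : ℝ) < i + m := by exact_mod_cast h'
  have hδ : 0 < π / m := by positivity
  have hδm : m * (π / m) = π := by field_simp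
  rw [sin_edgeAngle_sub]
  exact sin_pos_of_pos_of_lt_pi (by nlinarith) (by nlinarith)

lemma sin_edgeAngle_sub_neg {i j : ℕ} (h : i + m < j) (h' : j < i + 2 * m) :
    sin (edgeAngle m j - edgeAngle m i) < 0 := by
  have hm : 0 < m := by omega
  have h1 : (i : ℝ) + m < j := by exact_mod_cast h
  have h2 : (j : ℝ) < i + 2 * m := by exact_mod_cast h'
  have hδ : 0 < π / m := by positivity
  have hδm : m * (π / m) = π := by field_simp
  rw [sin_edgeAngle_sub, ← sin_sub_two_pi]
  exact sin_neg_of_neg_of_neg_pi_lt (by nlinarith) (by nlinarith)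

lemma sum_mul_sin_sub (hm : 2 ≤ m) {w : Fin (2 * m) → ℝ} (hw : w ∈ (edgeFamily hm).weights)
    (φ : ℝ) : ∑ i, w i * sin (edgeAngle m i - φ) = 0 := by
  obtain ⟨-, -, hc, hs⟩ := (mem_weights_edgeFamily_iff hm w).1 hw
  simp only [sin_sub, mul_sub, ← mul_assoc, Finset.sum_sub_distrib, ← Finset.sum_mul, hc, hs]
  ring

lemma sum_mul_cos_sub (hm : 2 ≤ m) {w : Fin (2 * m) → ℝ} (hw : w ∈ (edgeFamily hm).weights)
    (φ : ℝ) : ∑ i, w i * cos (edgeAngle m i - φ) = 0 := by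
  obtain ⟨-, -, hc, hs⟩ := (mem_weights_edgeFamily_iff hm w).1 hw
  simp only [cos_sub, mul_add, ← mul_assoc, Finset.sum_add_distrib, ← Finset.sum_mul, hc, hs]
  ring

/-- The function on `Fin n` with the values `a`, `b`, `c` at `i`, `j`, `k` and `0` elsewhere (for
distinct `i`, `j`, `k`). -/
noncomputable def tripleWeights (n i j k : ℕ) (a b c : ℝ) (l : Fin n) : ℝ :=
  (if (l : ℕ) = i then a else 0) + (if (l : ℕ) = j then b else 0) + (if (l : ℕ) = k then c else 0)

lemma sum_tripleWeights_mul {n i j k : ℕ} (hi : i < n) (hj : j < n) (hk : k < n) (a b c : ℝ)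
    (g : ℕ → ℝ) : ∑ l, tripleWeights n i j k a b c l * g l = a * g i + b * g j + c * g k := by
  simp only [tripleWeights, add_mul, Finset.sum_add_distrib, ite_mul, zero_mul]
  rw [Fin.sum_univ_eq_sum_range (fun l => if l = i then a * g l else 0),
    Fin.sum_univ_eq_sum_range (fun l => if l = j then b * g l else 0),
    Fin.sum_univ_eq_sum_range (fun l => if l = k then c * g l else 0)]
  simp [Finset.sum_ite_eq', hi, hj, hk]

lemma eq_tripleWeights {n i j k : ℕ} (hi : i < n) (hj : j < n) (hk : k < n) (hij : i ≠ j)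
    (hik : i ≠ k) (hjk : j ≠ k) (w : Fin n → ℝ)
    (h : ∀ l : Fin n, (l : ℕ) ≠ i → (l : ℕ) ≠ j → (l : ℕ) ≠ k → w l = 0) :
    w = tripleWeights n i j k (w ⟨i, hi⟩) (w ⟨j, hj⟩) (w ⟨k, hk⟩) := by
  ext ⟨l, hl⟩
  simp only [tripleWeights]
  by_cases h1 : l = i
  · subst h1; simp [hij, hik]
  by_cases h2 : l = j
  · subst h2; simp [hij.symm, hjk]
  by_cases h3 : l = k
  · subst h3; simp [hik.symm, hjk.symm]
  simpa [h1, h2, h3] using h ⟨l, hl⟩ h1 h2 h3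

/-- The weights of the two-outcome observable formed by two opposite edges. -/
noncomputable def oppositeWeights (m i : ℕ) (l : Fin (2 * m)) : ℝ :=
  if (l : ℕ) = i ∨ (l : ℕ) = i + m then 1 / 2 else 0

/-- The weights of the three-outcome observable formed by three edges, in the proportions of the
unique linear relation between the normals. -/
noncomputable def acuteWeights (m : ℕ) (t : ℕ × ℕ × ℕ) : Fin (2 * m) → ℝ :=
  let a := -sin (edgeAngle m t.2.2 - edgeAngle m t.1)
  let b := sin (edgeAngle m t.2.1 - edgeAngle m t.1)
  let c := sin (edgeAngle m t.2.2 - edgeAngle m t.2.1)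
  tripleWeights (2 * m) t.1 t.2.1 t.2.2 (c / (a + b + c)) (a / (a + b + c)) (b / (a + b + c))

lemma oppositeWeights_ne_zero_iff (i : ℕ) (l : Fin (2 * m)) :
    oppositeWeights m i l ≠ 0 ↔ (l : ℕ) = i ∨ (l : ℕ) = i + m := by
  simp [oppositeWeights, or_iff_not_imp_left]

lemma oppositeWeights_eq (hm : 2 ≤ m) (i : ℕ) :
    oppositeWeights m i = tripleWeights (2 * m) i (i + m) i (1 / 2) (1 / 2) 0 := by
  ext l
  simp only [oppositeWeights, tripleWeights, ite_self, add_zero]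
  by_cases h : (l : ℕ) = i
  · simp [h, show m ≠ 0 by omega]
  · simp [h]

lemma oppositeWeights_mem (hm : 2 ≤ m) {i : ℕ} (hi : i < m) :
    oppositeWeights m i ∈ (edgeFamily hm).weights := by
  rw [mem_weights_edgeFamily_iff]
  refine ⟨fun l => ?_, ?_⟩
  · simp only [oppositeWeights]
    split_ifs <;> norm_num
  · have := sum_tripleWeights_mul (n := 2 * m) (i := i) (j := i + m) (k := i) (by omega) (by omega)
      (by omega) (1 / 2) (1 / 2) 0
    rw [← oppositeWeights_eq hm] at this
    refine ⟨?_, (this (fun l => cos (edgeAngle m l))).trans ?_,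
      (this (fun l => sin (edgeAngle m l))).trans ?_⟩
    · have h1 := this fun _ => 1
      simp only [mul_one] at h1
      rw [h1]
      norm_num
    · rw [edgeAngle_add_half hm, cos_add_pi]; ring
    · rw [edgeAngle_add_half hm, sin_add_pi]; ring

lemma oppositeWeights_mem_extremePoints (hm : 2 ≤ m) {i : ℕ} (hi : i < m) :
    oppositeWeights m i ∈ (edgeFamily hm).weights.extremePoints ℝ := by
  rw [IndecomposableFamily.mem_extremePoints_weights_iff]
  refine ⟨oppositeWeights_mem hm hi, fun v hv h => ?_⟩
  -- the third index is a dummy outside the support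
  obtain ⟨k, hk, hki, hkm⟩ : ∃ k, k < 2 * m ∧ i ≠ k ∧ i + m ≠ k := by
    rcases Nat.eq_zero_or_pos i with rfl | h
    · exact ⟨1, by omega, by omega, by omega⟩
    · exact ⟨0, by omega, by omega, by omega⟩
  have hzero : ∀ l : Fin (2 * m), (l : ℕ) ≠ i → (l : ℕ) ≠ i + m → v l = 0 := fun l h1 h2 =>
    h l (by simp [oppositeWeights, h1, h2])
  have hv' := eq_tripleWeights (n := 2 * m) (i := i) (j := i + m) (k := k) (by omega) (by omega) hk
    (by omega) hki hkm v fun l h1 h2 _ => hzero l h1 h2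
  rw [hzero ⟨k, hk⟩ hki.symm hkm.symm] at hv'
  set a := v ⟨i, by omega⟩
  set b := v ⟨i + m, by omega⟩
  have hsum := sum_tripleWeights_mul (n := 2 * m) (i := i) (j := i + m) (k := k) (by omega)
    (by omega) hk a b 0
  rw [← hv'] at hsum
  have h1 := (hsum fun _ => 1).symm
  simp only [mul_one, ((mem_weights_edgeFamily_iff hm v).1 hv).2.1] at h1
  have h2 := (hsum fun l => cos (edgeAngle m l - edgeAngle m i)).symm
  rw [sum_mul_cos_sub hm hv, edgeAngle_add_half hm, add_sub_cancel_left, sub_self] at h2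
  simp only [cos_zero, cos_pi] at h2
  have ha : a = 1 / 2 := by linarith
  have hb : b = 1 / 2 := by linarith
  rw [hv', ha, hb, oppositeWeights_eq hm]
  ext l
  simp [tripleWeights]

lemma acute_sin_pos {i j k : ℕ} (h : (i, j, k) ∈ acuteTriples m) :
    0 < -sin (edgeAngle m k - edgeAngle m i) ∧ 0 < sin (edgeAngle m j - edgeAngle m i) ∧
      0 < sin (edgeAngle m k - edgeAngle m j) := by
  obtain ⟨h1, h2, h3, h4, h5, h6⟩ := h
  dsimp only at h1 h2 h3 h4 h5 h6
  exact ⟨neg_pos.2 (sin_edgeAngle_sub_neg h6 (by omega)), sin_edgeAngle_sub_pos h1 h4,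
    sin_edgeAngle_sub_pos h2 h5⟩

lemma acuteWeights_ne_zero_iff {i j k : ℕ} (h : (i, j, k) ∈ acuteTriples m) (l : Fin (2 * m)) :
    acuteWeights m (i, j, k) l ≠ 0 ↔ (l : ℕ) = i ∨ (l : ℕ) = j ∨ (l : ℕ) = k := by
  obtain ⟨ha, hb, hc⟩ := acute_sin_pos h
  obtain ⟨h1, h2, -⟩ := h
  dsimp only at h1 h2
  simp only [acuteWeights, tripleWeights]
  set a := -sin (edgeAngle m k - edgeAngle m i)
  set b := sin (edgeAngle m j - edgeAngle m i)
  set c := sin (edgeAngle m k - edgeAngle m j)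
  have hs : a + b + c ≠ 0 := by positivity
  by_cases hi : (l : ℕ) = i
  · simp [hi, show i ≠ j by omega, show i ≠ k by omega, hc.ne', hs]
  by_cases hj : (l : ℕ) = j
  · simp [hj, show j ≠ i by omega, show j ≠ k by omega, ha.ne', hs]
  by_cases hk : (l : ℕ) = k
  · simp [hk, show k ≠ i by omega, show k ≠ j by omega, hb.ne', hs]
  simp [hi, hj, hk]

lemma acuteWeights_mem (hm : 2 ≤ m) {t : ℕ × ℕ × ℕ} (h : t ∈ acuteTriples m) :
    acuteWeights m t ∈ (edgeFamily hm).weights := by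
  obtain ⟨i, j, k⟩ := t
  obtain ⟨ha, hb, hc⟩ := acute_sin_pos h
  obtain ⟨h1, h2, h3, -⟩ := h
  dsimp only at h1 h2 h3
  rw [mem_weights_edgeFamily_iff]
  have hsum := sum_tripleWeights_mul (n := 2 * m) (i := i) (j := j) (k := k) (by omega) (by omega)
      (by omega)
  simp only [acuteWeights]
  set a := -sin (edgeAngle m k - edgeAngle m i) with ha'
  set b := sin (edgeAngle m j - edgeAngle m i) with hb'
  set c := sin (edgeAngle m k - edgeAngle m j) with hc'
  have hs : 0 < a + b + c := by positivity
  refine ⟨fun l => ?_, ?_, (hsum _ _ _ (fun l => cos (edgeAngle m l))).trans ?_,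
    (hsum _ _ _ (fun l => sin (edgeAngle m l))).trans ?_⟩
  · simp only [tripleWeights]
    refine add_nonneg (add_nonneg ?_ ?_) ?_ <;> split_ifs <;> positivity
  · have := hsum (c / (a + b + c)) (a / (a + b + c)) (b / (a + b + c)) (fun _ => 1)
    simp only [mul_one] at this
    rw [this]
    field_simp
    ring
  · have : c * cos (edgeAngle m i) + a * cos (edgeAngle m j) + b * cos (edgeAngle m k) = 0 := by
      rw [ha', hb', hc', sin_sub, sin_sub, sin_sub]; ring
    rw [div_mul_eq_mul_div, div_mul_eq_mul_div, div_mul_eq_mul_div, ← add_div, ← add_div, this,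
      zero_div]
  · have : c * sin (edgeAngle m i) + a * sin (edgeAngle m j) + b * sin (edgeAngle m k) = 0 := by
      rw [ha', hb', hc', sin_sub, sin_sub, sin_sub]; ring
    rw [div_mul_eq_mul_div, div_mul_eq_mul_div, div_mul_eq_mul_div, ← add_div, ← add_div, this,
      zero_div]

lemma acuteWeights_mem_extremePoints (hm : 2 ≤ m) {t : ℕ × ℕ × ℕ} (ht : t ∈ acuteTriples m) :
    acuteWeights m t ∈ (edgeFamily hm).weights.extremePoints ℝ := by
  rw [IndecomposableFamily.mem_extremePoints_weights_iff]
  refine ⟨acuteWeights_mem hm ht, fun v hv h => ?_⟩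
  obtain ⟨i, j, k⟩ := t
  have hsupp := acuteWeights_ne_zero_iff ht
  obtain ⟨ha, hb, hc⟩ := acute_sin_pos ht
  obtain ⟨h1, h2, h3, -⟩ := ht
  dsimp only at h1 h2 h3
  have hv' := eq_tripleWeights (n := 2 * m) (i := i) (j := j) (k := k) (by omega) (by omega) h3
    (by omega) (by omega) (by omega) v fun l h1 h2 h3 => h l (by
      by_contra hne
      have := (hsupp l).1 hne
      omega)
  set x := v ⟨i, by omega⟩
  set y := v ⟨j, by omega⟩
  set z := v ⟨k, by omega⟩
  have hsum := sum_tripleWeights_mul (n := 2 * m) (i := i) (j := j) (k := k) (by omega)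
    (by omega) h3 x y z
  rw [← hv'] at hsum
  have e1 := (hsum fun _ => 1).symm
  simp only [mul_one, ((mem_weights_edgeFamily_iff hm v).1 hv).2.1] at e1
  have e2 := (hsum fun l => sin (edgeAngle m l - edgeAngle m i)).symm
  rw [sum_mul_sin_sub hm hv, sub_self, sin_zero] at e2
  have e3 := (hsum fun l => sin (edgeAngle m l - edgeAngle m j)).symm
  rw [sum_mul_sin_sub hm hv, sub_self, sin_zero,
    ← neg_sub (edgeAngle m j) (edgeAngle m i), sin_neg] at e3
  rw [hv']
  simp only [acuteWeights]
  set a := -sin (edgeAngle m k - edgeAngle m i) with ha'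
  set b := sin (edgeAngle m j - edgeAngle m i)
  set c := sin (edgeAngle m k - edgeAngle m j)
  have hs : 0 < a + b + c := by positivity
  rw [show sin (edgeAngle m k - edgeAngle m i) = -a by rw [ha', neg_neg]] at e2
  -- `(x, y, z)` is proportional to `(c, a, b)`
  have f1 : y * b = z * a := by linarith
  have f2 : x * b = z * c := by linarith
  have hz : z = b / (a + b + c) := by
    rw [eq_div_iff hs.ne']
    linear_combination b * e1 - f1 - f2
  have hx : x = c / (a + b + c) := by
    refine mul_right_cancel₀ hb.ne' (f2.trans ?_)
    rw [hz]; ring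
  have hy : y = a / (a + b + c) := by
    refine mul_right_cancel₀ hb.ne' (f1.trans ?_)
    rw [hz]; ring
  rw [hx, hy, hz]

/-- The support of any weights contains two opposite edges or an acute triple: otherwise all the
normals in the support would lie in a half-plane. -/
lemma exists_support (hm : 2 ≤ m) {w : Fin (2 * m) → ℝ} (hw : w ∈ (edgeFamily hm).weights) :
    (∃ i < m, ∀ l : Fin (2 * m), (l : ℕ) = i ∨ (l : ℕ) = i + m → w l ≠ 0) ∨
    ∃ i j k, (i, j, k) ∈ acuteTriples m ∧
      ∀ l : Fin (2 * m), (l : ℕ) = i ∨ (l : ℕ) = j ∨ (l : ℕ) = k → w l ≠ 0 := by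
  classical
  rw [or_iff_not_imp_left]
  intro hop
  have hanti : ∀ i l : Fin (2 * m), w i ≠ 0 → w l ≠ 0 → (l : ℕ) ≠ i + m := by
    intro i l hi hl h
    refine hop ⟨i, by omega, fun l' hl' => ?_⟩
    rcases hl' with h' | h'
    · rwa [Fin.ext h']
    · rwa [Fin.ext (h'.trans h.symm)]
  have hsum := ((mem_weights_edgeFamily_iff hm w).1 hw).2.1
  have hnn : ∀ l, 0 ≤ w l := hw.1
  let s : Finset (Fin (2 * m)) := Finset.univ.filter fun l => w l ≠ 0
  have hs : s.Nonempty := by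
    by_contra h
    rw [Finset.not_nonempty_iff_eq_empty, Finset.filter_eq_empty_iff] at h
    rw [Finset.sum_eq_zero fun l hl => by simpa using h hl] at hsum
    exact zero_ne_one hsum
  set i := s.min' hs
  have hwi : w i ≠ 0 := (Finset.mem_filter.1 (s.min'_mem hs)).2
  have himin : ∀ l, w l ≠ 0 → i ≤ l := fun l hl => s.min'_le l (by simp [s, hl])
  -- no vector of the support lies strictly on one side of a line unless another lies on the other
  have hside : ∀ j : Fin (2 * m),
      (∀ l, w l ≠ 0 → sin (edgeAngle m l - edgeAngle m j) ≤ 0) →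
      ∀ l, w l ≠ 0 → sin (edgeAngle m l - edgeAngle m j) = 0 := fun j h l hl => by
    have h0 := sum_mul_sin_sub hm hw (edgeAngle m j)
    rw [Finset.sum_eq_zero_iff_of_nonpos] at h0
    · exact (mul_eq_zero.1 (h0 l (Finset.mem_univ l))).resolve_left hl
    · intro l _
      by_cases hl : w l = 0
      · simp [hl]
      · exact mul_nonpos_of_nonneg_of_nonpos (hnn l) (h l hl)
  have hside' : ∀ j : Fin (2 * m),
      (∀ l, w l ≠ 0 → 0 ≤ sin (edgeAngle m l - edgeAngle m j)) →
      ∀ l, w l ≠ 0 → sin (edgeAngle m l - edgeAngle m j) = 0 := fun j h l hl => by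
    have h0 := sum_mul_sin_sub hm hw (edgeAngle m j)
    rw [Finset.sum_eq_zero_iff_of_nonneg] at h0
    · exact (mul_eq_zero.1 (h0 l (Finset.mem_univ l))).resolve_left hl
    · intro l _
      by_cases hl : w l = 0
      · simp [hl]
      · exact mul_nonneg (hnn l) (h l hl)
  obtain ⟨l₀, hl₀, hil₀⟩ : ∃ l, w l ≠ 0 ∧ l ≠ i := by
    by_contra! h
    have h0 := sum_mul_cos_sub hm hw (edgeAngle m i)
    rw [Finset.sum_eq_single i (fun l _ hl => by
      rw [not_imp_comm.1 (h l) hl, zero_mul]) (by simp)] at h0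
    simp [hwi] at h0
  have hclass : ∀ l, w l ≠ 0 → l ≠ i →
      ((i : ℕ) < l ∧ (l : ℕ) < i + m) ∨ ((i : ℕ) + m < l ∧ (l : ℕ) < 2 * m) := fun l hl hli => by
    have h1 : (i : ℕ) ≤ l := himin l hl
    have h2 := hanti i l hwi hl
    have h3 : (l : ℕ) ≠ i := fun h => hli (Fin.ext h)
    omega
  have hk : ∃ k, w k ≠ 0 ∧ (i : ℕ) + m < k := by
    by_contra! h
    have h0 := hside' i (fun l hl => by
      by_cases hli : l = i
      · simp [hli]
      rcases hclass l hl hli with h1 | h1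
      · exact (sin_edgeAngle_sub_pos h1.1 h1.2).le
      · have := h l hl
        omega) l₀ hl₀
    rcases hclass l₀ hl₀ hil₀ with h1 | h1
    · exact (sin_edgeAngle_sub_pos h1.1 h1.2).ne' h0
    · have := h l₀ hl₀
      omega
  have hj : ∃ j, w j ≠ 0 ∧ (i : ℕ) < j ∧ (j : ℕ) < i + m := by
    by_contra! h
    have h0 := hside i (fun l hl => by
      by_cases hli : l = i
      · simp [hli]
      rcases hclass l hl hli with h1 | h1
      · have := h l hl h1.1
        omega
      · exact (sin_edgeAngle_sub_neg h1.1 (by omega)).le) l₀ hl₀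
    rcases hclass l₀ hl₀ hil₀ with h1 | h1
    · have := h l₀ hl₀ h1.1
      omega
    · exact (sin_edgeAngle_sub_neg h1.1 (by omega)).ne h0
  let sj : Finset (Fin (2 * m)) :=
    Finset.univ.filter fun j => w j ≠ 0 ∧ (i : ℕ) < j ∧ (j : ℕ) < i + m
  let sk : Finset (Fin (2 * m)) := Finset.univ.filter fun k => w k ≠ 0 ∧ (i : ℕ) + m < k
  have hsj : sj.Nonempty := hj.imp fun j hj => by simp only [sj, Finset.mem_filter]; simpa using hj
  have hsk : sk.Nonempty := hk.imp fun k hk => by simp only [sk, Finset.mem_filter]; simpa using hk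
  set j := sj.max' hsj
  set k := sk.min' hsk
  obtain ⟨hwj, hij, hjm⟩ := (Finset.mem_filter.1 (sj.max'_mem hsj)).2
  obtain ⟨hwk, hik⟩ := (Finset.mem_filter.1 (sk.min'_mem hsk)).2
  have hjmax : ∀ l, w l ≠ 0 → (i : ℕ) < l → (l : ℕ) < i + m → l ≤ j := fun l h1 h2 h3 =>
    sj.le_max' l (by simp only [sj, Finset.mem_filter]; exact ⟨Finset.mem_univ _, h1, h2, h3⟩)
  have hkmin : ∀ l, w l ≠ 0 → (i : ℕ) + m < l → k ≤ l := fun l h1 h2 =>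
    sk.min'_le l (by simp only [sk, Finset.mem_filter]; exact ⟨Finset.mem_univ _, h1, h2⟩)
  have hkj : (k : ℕ) < j + m := by
    by_contra! hge
    have hne := hanti j k hwj hwk
    have hneg : ∀ l, w l ≠ 0 → l ≠ j → sin (edgeAngle m l - edgeAngle m j) < 0 := by
      intro l hl hlj
      have hlj' : (l : ℕ) ≠ j := fun h => hlj (Fin.ext h)
      have hlow : (l : ℕ) < j → sin (edgeAngle m l - edgeAngle m j) < 0 := fun h => by
        rw [← neg_sub, sin_neg, neg_lt_zero]
        have : (i : ℕ) ≤ l := himin l hl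
        exact sin_edgeAngle_sub_pos h (by omega)
      by_cases hli : l = i
      · exact hlow (hli ▸ hij)
      rcases hclass l hl hli with h1 | h1
      · have : (l : ℕ) ≤ j := hjmax l hl h1.1 h1.2
        exact hlow (by omega)
      · have : (k : ℕ) ≤ l := hkmin l hl h1.1
        exact sin_edgeAngle_sub_neg (by omega) (by omega)
    have hij' : i ≠ j := fun h => hij.ne (congrArg Fin.val h)
    exact (hneg i hwi hij').ne (hside j (fun l hl => by
      by_cases hlj : l = j
      · simp [hlj]
      · exact (hneg l hl hlj).le) i hwi)
  refine ⟨i, j, k, ⟨hij, ?_, k.2, hjm, hkj, hik⟩, ?_⟩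
  · change (j : ℕ) < k
    omega
  · rintro l (h | h | h)
    · rwa [Fin.ext h]
    · rwa [Fin.ext h]
    · rwa [Fin.ext h]

lemma extremePoints_weights_edgeFamily (hm : 2 ≤ m) :
    (edgeFamily hm).weights.extremePoints ℝ =
      oppositeWeights m '' Set.Iio m ∪ acuteWeights m '' acuteTriples m := by
  refine Set.Subset.antisymm (fun w hw => ?_) (Set.union_subset ?_ ?_)
  · rw [IndecomposableFamily.mem_extremePoints_weights_iff] at hw
    rcases exists_support hm hw.1 with ⟨i, hi, h⟩ | ⟨i, j, k, ht, h⟩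
    · refine Or.inl ⟨i, hi, hw.2 _ (oppositeWeights_mem hm hi) fun l hl => ?_⟩
      by_contra hne
      exact h l ((oppositeWeights_ne_zero_iff i l).1 hne) hl
    · refine Or.inr ⟨_, ht, hw.2 _ (acuteWeights_mem hm ht) fun l hl => ?_⟩
      by_contra hne
      exact h l ((acuteWeights_ne_zero_iff ht l).1 hne) hl
  · rintro _ ⟨i, hi, rfl⟩
    exact oppositeWeights_mem_extremePoints hm hi
  · rintro _ ⟨t, ht, rfl⟩
    exact acuteWeights_mem_extremePoints hm ht

lemma finite_acuteTriples (m : ℕ) : (acuteTriples m).Finite := by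
  refine (((Set.finite_Iio (2 * m)).prod
    ((Set.finite_Iio (2 * m)).prod (Set.finite_Iio (2 * m))))).subset ?_
  rintro ⟨i, j, k⟩ ⟨h1, h2, h3, -⟩
  dsimp only at h1 h2 h3
  exact ⟨Set.mem_Iio.2 (by dsimp only; omega), Set.mem_Iio.2 (by dsimp only; omega),
    Set.mem_Iio.2 h3⟩

lemma ncard_extremePoints_weights_edgeFamily (hm : 2 ≤ m) :
    ((edgeFamily hm).weights.extremePoints ℝ).ncard = m + (acuteTriples m).ncard := by
  have hopp : Set.InjOn (oppositeWeights m) (Set.Iio m) := by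
    intro i hi i' hi' h
    rw [Set.mem_Iio] at hi hi'
    have := (oppositeWeights_ne_zero_iff (m := m) i' ⟨i, by omega⟩).1
      (h ▸ (oppositeWeights_ne_zero_iff i ⟨i, by omega⟩).2 (Or.inl rfl))
    dsimp only at this
    omega
  have hacute : Set.InjOn (acuteWeights m) (acuteTriples m) := by
    rintro ⟨i, j, k⟩ ht ⟨i', j', k'⟩ ht' h
    have e : ∀ l : Fin (2 * m), ((l : ℕ) = i ∨ (l : ℕ) = j ∨ (l : ℕ) = k) ↔
        ((l : ℕ) = i' ∨ (l : ℕ) = j' ∨ (l : ℕ) = k') := fun l => by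
      rw [← acuteWeights_ne_zero_iff ht, h, acuteWeights_ne_zero_iff ht']
    obtain ⟨h1, h2, h3, -⟩ := ht
    obtain ⟨h1', h2', h3', -⟩ := ht'
    dsimp only at h1 h2 h3 h1' h2' h3'
    have ei := e ⟨i, by omega⟩
    have ej := e ⟨j, by omega⟩
    have ek := e ⟨k, by omega⟩
    dsimp only at ei ej ek
    simp only [Prod.mk.injEq]
    omega
  have hdisj : Disjoint (oppositeWeights m '' Set.Iio m) (acuteWeights m '' acuteTriples m) := by
    rw [Set.disjoint_left]
    rintro _ ⟨p, hp, rfl⟩ ⟨⟨i, j, k⟩, ht, h⟩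
    have e : ∀ l : Fin (2 * m), ((l : ℕ) = i ∨ (l : ℕ) = j ∨ (l : ℕ) = k) ↔
        ((l : ℕ) = p ∨ (l : ℕ) = p + m) := fun l => by
      rw [← acuteWeights_ne_zero_iff ht, h, oppositeWeights_ne_zero_iff]
    obtain ⟨h1, h2, h3, -⟩ := ht
    dsimp only at h1 h2 h3
    have ei := e ⟨i, by omega⟩
    have ej := e ⟨j, by omega⟩
    have ek := e ⟨k, by omega⟩
    dsimp only at ei ej ek
    omega
  rw [extremePoints_weights_edgeFamily,
    Set.ncard_union_eq hdisj ((Set.finite_Iio m).image _) ((finite_acuteTriples m).image _),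
    hopp.ncard_image, hacute.ncard_image]
  congr 1
  rw [← Finset.coe_range, Set.ncard_coe_finset, Finset.card_range]

end Vertices

end GPT

theorem mainTheorem6 (m : ℕ) (hm : 2 ≤ m) :
    ∃ N : ℕ,
      GPT.minSimulationNumber
        (Set.univ : Set (GPT.Observable (GPT.polygonStateSpace (2 * m)))) = (N : ℕ∞) ∧
      (N : ℝ) = (m : ℝ) + (m : ℝ) * ((m : ℝ) - 1) * ((m : ℝ) - 2) / 3 := by
  refine ⟨m + (GPT.acuteTriples m).ncard, ?_, ?_⟩
  · rw [(GPT.edgeFamily hm).minSimulationNumber_univ,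
      GPT.ncard_extremePoints_weights_edgeFamily hm]
  · rw [Nat.cast_add, GPT.ncard_acuteTriples]
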